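/- Let $\Omega^+$ be the cone of positive positive definite functions on $\mathbb{R}$, i.e. of the continuous even functions $f:\mathbb{R}\to[0,\infty)$ such that $\sum_{j,k=1}^n c_j\overline{c_k}\,f(x_j-x_k)\ge 0$ for all $n$, all $x_1,\dots,x_n\in\mathbb{R}$ and all $c_1,\dots,c_n\in\mathbb{C}$. A function $f\in\Omega^+$ is an extremal ray generator of $\Omega^+$ if $\{g\in\Omega^+ : f-g\in\Omega^+\}=\{\lambda f : 0\le\lambda\le 1\}$. A function $f:\mathbb{R}\to\mathbb{R}$ is of Pólya type if it is even, continuous, convex on $[0,\infty)$, and $f(x)\to 0$ as $x\to\infty$. Let $f$ be a function of Pólya type. Then $f$ is positive positive definite, i.e. $f\in\Omega^+$. Moreover, if $f$ is not identically zero, then $f$ is an extremal ray generator of $\Omega^+$ if and only if $f=c\,\chi_{[-r/2,r/2]}*\chi_{[-r/2,r/2]}$ for some $r>0$ and some $c>0$, where $\chi_{[-r/2,r/2]}$ is the characteristic function of $[-r/2,r/2]$ and $*$ is convolution with respect to Lebesgue measure. -/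

import Mathlib

open scoped ComplexOrder Convolution

/-- A function `f : ℝ → ℂ` is positive definite (in the semidefinite sense usual for functions):
`∑ j k, c j * conj (c k) * f (x j - x k)` is a nonnegative real number for all choices of points
and complex coefficients. Continuity is not part of this definition. -/
def IsPositiveDefiniteFun (f : ℝ → ℂ) : Prop :=
  ∀ (n : ℕ) (x : Fin n → ℝ) (c : Fin n → ℂ),
    0 ≤ ∑ j, ∑ k, c j * starRingEnd ℂ (c k) * f (x j - x k)

/-- The cone of positive positive definite functions on `ℝ`: continuous, radial (that is, even),
positive definite and nonnegative functions. -/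
def posPosDefCone : Set (ℝ → ℝ) :=
  {f | Continuous f ∧ Function.Even f ∧ IsPositiveDefiniteFun (fun x => (f x : ℂ)) ∧
    ∀ x, 0 ≤ f x}

/-- The interval `I(f) = Ω⁺ ∩ (f - Ω⁺)` generated by `f` in the cone `Ω⁺` of positive positive
definite functions. -/
def posPosDefInterval (f : ℝ → ℝ) : Set (ℝ → ℝ) :=
  {g | g ∈ posPosDefCone ∧ f - g ∈ posPosDefCone}

/-- `f` is an extremal ray generator of the cone of positive positive definite functions:
`f` lies in the cone and `I(f) = {t f : 0 ≤ t ≤ 1}`. (With this definition `f = 0` qualifies.) -/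
def IsExtremalRayGenerator (f : ℝ → ℝ) : Prop :=
  f ∈ posPosDefCone ∧ posPosDefInterval f = (fun t : ℝ => t • f) '' Set.Icc 0 1

/-- Pólya type functions. -/
structure IsPolyaType (f : ℝ → ℝ) : Prop where
  even : Function.Even f
  continuous : Continuous f
  convexOn : ConvexOn ℝ (Set.Ici 0) f
  tendsto_zero : Filter.Tendsto f Filter.atTop (nhds 0)

/-- The characteristic function of the interval `[-r/2, r/2]`. -/
noncomputable def intervalChar (r : ℝ) : ℝ → ℝ :=
  Set.indicator (Set.Icc (-r / 2) (r / 2)) (fun _ => 1)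

/-- The convolution `χ_{[-r/2, r/2]} * χ_{[-r/2, r/2]}` with respect to Lebesgue measure. -/
noncomputable def charConvChar (r : ℝ) : ℝ → ℝ :=
  intervalChar r ⋆[ContinuousLinearMap.mul ℝ ℝ, MeasureTheory.volume] intervalChar r

/-! A Pólya function is positive definite because, on a lattice, a convex decreasing nonnegative
sequence is a nonnegative combination of tents and a constant (`eq_sum_secondDiff_tent`), and tents
are Gram kernels (`intTent`). Refining the lattice and continuity give all real points.

If `f` is extremal and `f s > 0`, cut `f` along a supporting line at `s`. The excess over the line
on `[-s, s]` and the remainder are both of Pólya type. The excess vanishes at `s`, so extremality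
makes it zero. Hence `f` is affine on `[0, ∞)` as long as it is positive, that is, a tent.

Conversely, let `g` and `f - g` lie in the cone for a tent `f`. Pointwise nonnegativity confines the
support of `g` to that of `f`. On a lattice dividing the support, the symbol of `g` on the unit
circle lies between 0 and that of `f`, a multiple of `|1 + z + ... + z ^ L| ^ 2`, whose zeros all
lie on the circle. Domination then forces divisibility, and degrees leave only a constant factor
(`eq_tent_on_lattice`). Rational multiples of the radius are dense. -/

/-- A real kernel whose complex quadratic form is nonnegative. -/
def IsPSDKernel {ι : Type*} [Fintype ι] (K : ι → ι → ℝ) : Prop :=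
  ∀ c : ι → ℂ, 0 ≤ ∑ j, ∑ k, c j * starRingEnd ℂ (c k) * (K j k : ℂ)

/-! ### Positive semidefinite kernels -/

namespace IsPSDKernel

variable {ι : Type*} [Fintype ι]

theorem add {K L : ι → ι → ℝ} (hK : IsPSDKernel K) (hL : IsPSDKernel L) :
    IsPSDKernel fun j k => K j k + L j k := fun c => by
  simpa [mul_add, Finset.sum_add_distrib] using add_nonneg (hK c) (hL c)

theorem const_mul {K : ι → ι → ℝ} (hK : IsPSDKernel K) {a : ℝ} (ha : 0 ≤ a) :
    IsPSDKernel fun j k => a * K j k := fun c => by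
  have h := mul_nonneg (Complex.zero_le_real.2 ha) (hK c)
  simp only [Finset.mul_sum] at h
  refine h.trans_eq (Finset.sum_congr rfl fun j _ => Finset.sum_congr rfl fun k _ => ?_)
  push_cast
  ring

theorem zero : IsPSDKernel fun _ _ : ι => 0 := fun c => by simp

theorem sum {α : Type*} (s : Finset α) {K : α → ι → ι → ℝ} (hK : ∀ a ∈ s, IsPSDKernel (K a)) :
    IsPSDKernel fun j k => ∑ a ∈ s, K a j k := by
  classical
  induction s using Finset.induction_on with
  | empty => simpa using zero
  | insert a s ha ih =>
    simp only [Finset.sum_insert ha]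
    exact (hK a (by simp)).add (ih fun b hb => hK b (by simp [hb]))

theorem rankOne (v : ι → ℝ) : IsPSDKernel fun j k => v j * v k := fun c => by
  have h : ∑ j, ∑ k, c j * starRingEnd ℂ (c k) * ((v j * v k : ℝ) : ℂ) =
      (∑ j, c j * v j) * starRingEnd ℂ (∑ j, c j * v j) := by
    simp only [map_sum, map_mul, Complex.conj_ofReal, Finset.sum_mul_sum, Complex.ofReal_mul]
    exact Finset.sum_congr rfl fun j _ => Finset.sum_congr rfl fun k _ => by ring
  rw [h, Complex.mul_conj]
  exact Complex.zero_le_real.2 (Complex.normSq_nonneg _)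

theorem one : IsPSDKernel fun _ _ : ι => 1 := by
  simpa using rankOne fun _ : ι => 1

/-- Integer tent functions are positive definite. -/
theorem intTent (m : ι → ℤ) (n : ℕ) :
    IsPSDKernel fun j k => ((n - (m j - m k).natAbs : ℕ) : ℝ) := by
  classical
  -- Intervals of `n` integers starting at `m j` and `m k` overlap in `n - |m j - m k|` points,
  -- truncated at 0. The kernel is thus the Gram kernel of their indicators.
  let s : Finset ℤ := Finset.univ.biUnion fun j => Finset.Ico (m j) (m j + n)
  have h : IsPSDKernel fun j k => ∑ p ∈ s,
      (if p ∈ Finset.Ico (m j) (m j + n) then (1 : ℝ) else 0) *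
        (if p ∈ Finset.Ico (m k) (m k + n) then 1 else 0) :=
    sum s fun p _ => rankOne fun j => if p ∈ Finset.Ico (m j) (m j + n) then 1 else 0
  convert h using 3 with j k
  simp only [← ite_and, mul_ite, mul_one, mul_zero, Finset.sum_boole]
  have hs : ({p ∈ s | p ∈ Finset.Ico (m k) (m k + n) ∧ p ∈ Finset.Ico (m j) (m j + n)}) =
      Finset.Ico (max (m j) (m k)) (min (m j + n) (m k + n)) := by
    ext p
    simp only [s, Finset.mem_filter, Finset.mem_biUnion, Finset.mem_univ, true_and,
      Finset.mem_Ico]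
    constructor
    · rintro ⟨-, h⟩
      omega
    · intro h
      exact ⟨⟨j, by omega⟩, by omega⟩
  rw [hs, Int.card_Ico]
  congr 1
  omega

end IsPSDKernel

/-- A sequence as a combination of tents, with its second differences as coefficients. -/
theorem eq_sum_secondDiff_tent (u : ℕ → ℝ) {i M : ℕ} (hi : i ≤ M) :
    u i = (∑ k ∈ Finset.range M, (u k - 2 * u (k + 1) + u (k + 2)) * ((k + 1 - i : ℕ) : ℝ)) +
      ((u M - u (M + 1)) * ((M - i : ℕ) : ℝ) + u M * 1) := by
  induction M, hi using Nat.le_induction with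
  | base =>
    rw [Finset.sum_eq_zero]
    · simp
    · intro k hk
      rw [Nat.sub_eq_zero_of_le (by simpa using hk)]
      simp
  | succ M hM ih =>
    rw [Finset.sum_range_succ, ih, Nat.cast_sub hM, Nat.cast_sub (hM.trans M.le_succ)]
    push_cast
    ring

/-! ### Pólya's criterion -/

namespace IsPolyaType

variable {f : ℝ → ℝ}

/-- By convexity a single strict increase would force linear growth, against the limit 0. -/
theorem antitoneOn (hf : IsPolyaType f) : AntitoneOn f (Set.Ici 0) := by
  intro x hx y hy hxy
  by_contra! hlt
  have hxy' : x < y := hxy.lt_of_ne (by rintro rfl; exact lt_irrefl _ hlt)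
  have hs : 0 < (f y - f x) / (y - x) := div_pos (sub_pos.2 hlt) (sub_pos.2 hxy')
  have hlim : Filter.Tendsto (fun z => f y + (f y - f x) / (y - x) * (z - y))
      Filter.atTop Filter.atTop :=
    Filter.tendsto_atTop_add_const_left _ _
      ((Filter.tendsto_atTop_add_const_right _ (-y) Filter.tendsto_id).const_mul_atTop hs)
  refine not_tendsto_nhds_of_tendsto_atTop (Filter.tendsto_atTop_mono' _ ?_ hlim) _
    hf.tendsto_zero
  filter_upwards [Filter.eventually_gt_atTop y] with z hz
  have h := hf.convexOn.slope_mono_adjacent hx (show (0 : ℝ) ≤ z from le_trans hy hz.le) hxy' hz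
  rw [le_div_iff₀ (sub_pos.2 hz)] at h
  linarith

theorem apply_abs (hf : IsPolyaType f) (x : ℝ) : f |x| = f x := by
  rcases abs_choice x with h | h <;> rw [h]
  exact hf.even x

theorem nonneg (hf : IsPolyaType f) (x : ℝ) : 0 ≤ f x := by
  rw [← hf.apply_abs]
  refine le_of_tendsto hf.tendsto_zero ?_
  filter_upwards [Filter.eventually_ge_atTop |x|] with z hz
  exact hf.antitoneOn (abs_nonneg x) ((abs_nonneg x).trans hz) hz

theorem isPSDKernel_lattice (hf : IsPolyaType f) {ι : Type*} [Fintype ι] (m : ι → ℤ) {h : ℝ}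
    (hh : 0 ≤ h) : IsPSDKernel fun j k => f ((m j - m k : ℤ) * h) := by
  classical
  let u : ℕ → ℝ := fun i => f (i * h)
  have hu : Antitone u := fun i j hij =>
    hf.antitoneOn (show (0 : ℝ) ≤ i * h by positivity) (show (0 : ℝ) ≤ j * h by positivity)
      (by gcongr)
  have hconv : ∀ k, 0 ≤ u k - 2 * u (k + 1) + u (k + 2) := fun k => by
    have h2 := hf.convexOn.2 (show (0 : ℝ) ≤ k * h by positivity)
      (show (0 : ℝ) ≤ (k + 2 : ℕ) * h by positivity) (by norm_num : (0 : ℝ) ≤ 1 / 2)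
      (by norm_num : (0 : ℝ) ≤ 1 / 2) (by norm_num)
    have h3 : (1 / 2 : ℝ) • (k * h) + (1 / 2 : ℝ) • ((k + 2 : ℕ) * h) = (k + 1 : ℕ) * h := by
      push_cast [smul_eq_mul]
      ring
    rw [h3] at h2
    simp only [smul_eq_mul] at h2
    change f _ ≤ 1 / 2 * u k + 1 / 2 * u (k + 2) at h2
    change u (k + 1) ≤ _ at h2
    linarith
  -- Any common bound on the differences serves: one tent expansion must hold for all pairs.
  let M : ℕ := ∑ j, ∑ k, (m j - m k).natAbs
  have hM : ∀ j k, (m j - m k).natAbs ≤ M := fun j k =>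
    (Finset.single_le_sum (f := fun k => (m j - m k).natAbs) (fun _ _ => Nat.zero_le _)
      (Finset.mem_univ k)).trans
      (Finset.single_le_sum (f := fun j => ∑ k, (m j - m k).natAbs) (fun _ _ => Nat.zero_le _)
        (Finset.mem_univ j))
  have key := (IsPSDKernel.sum (Finset.range M) fun k _ =>
    (IsPSDKernel.intTent m (k + 1)).const_mul (hconv k)).add
    (((IsPSDKernel.intTent m M).const_mul (sub_nonneg.2 (hu M.le_succ))).add
      ((IsPSDKernel.one (ι := ι)).const_mul (hf.nonneg (M * h))))
  convert key using 3 with j k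
  rw [← eq_sum_secondDiff_tent u (hM j k)]
  simp only [u]
  rw [Nat.cast_natAbs, ← hf.apply_abs, abs_mul, abs_of_nonneg hh, Int.cast_abs]

theorem mem_posPosDefCone (hf : IsPolyaType f) : f ∈ posPosDefCone := by
  refine ⟨hf.continuous, hf.even, fun n x c => ?_, hf.nonneg⟩
  have hx : ∀ j, Filter.Tendsto (fun N : ℕ => (⌊x j * (N + 1)⌋ : ℝ) * (1 / ((N : ℝ) + 1)))
      Filter.atTop (nhds (x j)) := fun j => by
    have h0 : Filter.Tendsto (fun N : ℕ => x j - 1 / ((N : ℝ) + 1)) Filter.atTop (nhds (x j)) := by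
      simpa using tendsto_one_div_add_atTop_nhds_zero_nat.const_sub (x j)
    refine tendsto_of_tendsto_of_tendsto_of_le_of_le h0 tendsto_const_nhds (fun N => ?_)
      fun N => ?_
    · have hN : (0 : ℝ) < (N : ℝ) + 1 := by positivity
      have := Int.sub_one_lt_floor (x j * (N + 1))
      change x j - 1 / ((N : ℝ) + 1) ≤ _
      rw [mul_one_div, le_div_iff₀ hN, sub_mul, one_div, inv_mul_cancel₀ hN.ne']
      exact this.le
    · have hN : (0 : ℝ) < (N : ℝ) + 1 := by positivity
      change _ * (1 / ((N : ℝ) + 1)) ≤ x j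
      rw [mul_one_div, div_le_iff₀ hN]
      exact Int.floor_le _
  have hlim : Filter.Tendsto (fun N : ℕ => ∑ j, ∑ k, c j * starRingEnd ℂ (c k) *
      ((f ((⌊x j * (N + 1)⌋ - ⌊x k * (N + 1)⌋ : ℤ) * (1 / ((N : ℝ) + 1))) : ℝ) : ℂ))
      Filter.atTop (nhds (∑ j, ∑ k, c j * starRingEnd ℂ (c k) * (f (x j - x k) : ℂ))) := by
    refine tendsto_finsetSum _ fun j _ => tendsto_finsetSum _ fun k _ => ?_
    refine ((Complex.continuous_ofReal.tendsto _).comp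
      ((hf.continuous.tendsto _).comp ?_)).const_mul _
    simpa [sub_mul] using (hx j).sub (hx k)
  exact ge_of_tendsto' hlim fun N =>
    hf.isPSDKernel_lattice (fun j => ⌊x j * (N + 1)⌋) (by positivity) c

end IsPolyaType

/-! ### Extremal Pólya functions are tents -/

theorem charConvChar_apply {r : ℝ} (x : ℝ) : charConvChar r x = max (r - |x|) 0 := by
  unfold charConvChar MeasureTheory.convolution intervalChar
  have h : ∀ t, (ContinuousLinearMap.mul ℝ ℝ)
      ((Set.Icc (-r / 2) (r / 2)).indicator (fun _ => (1 : ℝ)) t)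
      ((Set.Icc (-r / 2) (r / 2)).indicator (fun _ => (1 : ℝ)) (x - t)) =
      (Set.Icc (max (-r / 2) (x - r / 2)) (min (r / 2) (x + r / 2))).indicator
        (fun _ => (1 : ℝ)) t := by
    intro t
    simp only [Set.indicator_apply, Set.mem_Icc, ContinuousLinearMap.mul_apply', sup_le_iff,
      le_inf_iff, mul_ite, mul_one, mul_zero, ← ite_and]
    congr 1
    apply propext
    constructor <;> rintro ⟨⟨h1, h2⟩, h3, h4⟩ <;> refine ⟨⟨?_, ?_⟩, ?_, ?_⟩ <;> linarith
  simp only [h]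
  rw [MeasureTheory.integral_indicator measurableSet_Icc, MeasureTheory.setIntegral_const,
    Real.volume_real_Icc, smul_eq_mul, mul_one]
  congr 1
  rcases le_total 0 x with hx | hx
  · rw [abs_of_nonneg hx, max_eq_right (by linarith), min_eq_left (by linarith)]
    ring
  · rw [abs_of_nonpos hx, max_eq_left (by linarith), min_eq_right (by linarith)]
    ring

namespace IsPolyaType

variable {f : ℝ → ℝ}

/-- A supporting line at an interior point. -/
theorem exists_supporting_line (hf : IsPolyaType f) {s : ℝ} (hs : 0 < s) :
    ∃ a, ∀ x, 0 ≤ x → f s + a * (x - s) ≤ f x := by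
  have hint : s ∈ interior (Set.Ici (0 : ℝ)) := by rwa [interior_Ici]
  refine ⟨derivWithin f (Set.Ioi s) s, fun x hx => ?_⟩
  rcases lt_trichotomy x s with h | rfl | h
  · have h1 := (hf.convexOn.slope_le_leftDeriv_of_mem_interior hx hint h).trans
      (hf.convexOn.leftDeriv_le_rightDeriv_of_mem_interior hint)
    rw [slope_def_field, div_le_iff₀ (sub_pos.2 h)] at h1
    linarith
  · simp
  · have h1 := hf.convexOn.rightDeriv_le_slope_of_mem_interior hint
      (show (0 : ℝ) ≤ x from hx) h
    rw [slope_def_field, le_div_iff₀ (sub_pos.2 h)] at h1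
    linarith

theorem eq_affine_of_extremal (hf : IsPolyaType f)
    (he : posPosDefInterval f = (fun t : ℝ => t • f) '' Set.Icc 0 1) {s : ℝ} (hs : 0 < s)
    (hfs : 0 < f s) : ∃ a, ∀ x, 0 ≤ x → x ≤ s → f x = f s + a * (x - s) := by
  obtain ⟨a, ha⟩ := hf.exists_supporting_line hs
  refine ⟨a, ?_⟩
  set u : ℝ → ℝ := fun x => f x - (f s + a * (x - s)) with hu
  have hu0 : ∀ x, 0 ≤ x → 0 ≤ u x := fun x hx => sub_nonneg.2 (ha x hx)
  have hus : u s = 0 := by simp [hu]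
  have huc : ConvexOn ℝ (Set.Ici 0) u := by
    refine hf.convexOn.sub ⟨convex_Ici 0, fun x _ y _ p q _ _ hpq => le_of_eq ?_⟩
    simp only [smul_eq_mul]
    obtain rfl := eq_sub_of_add_eq hpq
    ring
  have hucont : Continuous u := hf.continuous.sub (by fun_prop)
  have hanti : AntitoneOn u (Set.Icc 0 s) := by
    intro x hx y hy hxy
    have := huc.le_on_segment (show (0 : ℝ) ≤ x from hx.1) (show (0 : ℝ) ≤ s from hs.le)
      (by rw [segment_eq_Icc (show x ≤ s from hx.2)]; exact ⟨hxy, hy.2⟩ : y ∈ segment ℝ x s)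
    rwa [hus, max_eq_left (hu0 x hx.1)] at this
  have hmono : MonotoneOn u (Set.Ici s) := by
    intro x hx y hy hxy
    have := huc.le_on_segment (show (0 : ℝ) ≤ s from hs.le)
      (show (0 : ℝ) ≤ y from hs.le.trans hy)
      (by rw [segment_eq_Icc (show s ≤ y from hy)]; exact ⟨hx, hxy⟩ : x ∈ segment ℝ s y)
    rwa [hus, max_eq_right (hu0 y (hs.le.trans hy))] at this
  have hmin_im : (fun x => min x s) '' Set.Ici 0 = Set.Icc 0 s := by
    ext y
    constructor
    · rintro ⟨x, hx, rfl⟩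
      exact ⟨le_min (show (0 : ℝ) ≤ x from hx) hs.le, min_le_right x s⟩
    · exact fun hy => ⟨y, hy.1, min_eq_left hy.2⟩
  have hmax_im : (fun x => max x s) '' Set.Ici 0 = Set.Ici s := by
    ext y
    constructor
    · rintro ⟨x, hx, rfl⟩
      exact le_max_right x s
    · exact fun hy => ⟨y, hs.le.trans hy, max_eq_left hy⟩
  have hg : IsPolyaType fun x => u (min |x| s) := by
    refine ⟨fun x => by simp, by fun_prop, ?_, ?_⟩
    · refine ConvexOn.congr (f := u ∘ fun x => min x s) ?_ fun x hx => ?_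
      · refine ConvexOn.comp_concaveOn ?_
          ((concaveOn_id (convex_Ici 0)).inf (concaveOn_const s (convex_Ici 0))) ?_
        · exact (huc.subset Set.Icc_subset_Ici_self (convex_Icc 0 s)).subset hmin_im.le
            (hmin_im ▸ convex_Icc 0 s)
        · exact hanti.mono hmin_im.le
      · simp [abs_of_nonneg (show (0 : ℝ) ≤ x from hx)]
    · refine tendsto_const_nhds.congr' ?_
      filter_upwards [Filter.eventually_ge_atTop s] with x hx
      rw [abs_of_nonneg (hs.le.trans hx), min_eq_right hx, hus]
  -- The remainder follows the line up to `s` and `f` beyond; in this form its convexity is visible.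
  have hsum : ∀ x, f x - u (min |x| s) = f s + a * (|x| - s) + u (max |x| s) := by
    intro x
    have h1 : u |x| = f x - (f s + a * (|x| - s)) := by rw [← hf.apply_abs x]
    rcases le_total |x| s with h | h
    · rw [min_eq_left h, max_eq_right h, hus]
      linarith
    · rw [min_eq_right h, max_eq_left h, hus]
      linarith
  have hh : IsPolyaType (f - fun x => u (min |x| s)) := by
    refine ⟨fun x => by simp [hf.even x], hf.continuous.sub hg.continuous, ?_, ?_⟩
    · refine ConvexOn.congr (f := (fun x => f s + a * (x - s)) + u ∘ fun x => max x s) ?_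
        fun x hx => ?_
      · refine ConvexOn.add ⟨convex_Ici 0, fun x _ y _ p q _ _ hpq => le_of_eq ?_⟩ ?_
        · simp only [smul_eq_mul]
          obtain rfl := eq_sub_of_add_eq hpq
          ring
        · refine ConvexOn.comp ?_
            ((convexOn_id (convex_Ici 0)).sup (convexOn_const s (convex_Ici 0))) ?_
          · exact (huc.subset (Set.Ici_subset_Ici.2 hs.le) (convex_Ici s)).subset hmax_im.le
              (hmax_im ▸ convex_Ici s)
          · exact hmono.mono hmax_im.le
      · have := hsum x
        rw [abs_of_nonneg (show (0 : ℝ) ≤ x from hx)] at this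
        simpa [abs_of_nonneg (show (0 : ℝ) ≤ x from hx)] using this.symm
    · rw [← sub_zero (0 : ℝ)]
      exact hf.tendsto_zero.sub hg.tendsto_zero
  have hmem : (fun x => u (min |x| s)) ∈ posPosDefInterval f :=
    ⟨hg.mem_posPosDefCone, hh.mem_posPosDefCone⟩
  rw [he] at hmem
  obtain ⟨t, -, ht⟩ := hmem
  have ht0 : t = 0 := by
    have := congrFun ht s
    simp only [Pi.smul_apply, smul_eq_mul, abs_of_pos hs, min_self, hus] at this
    exact (mul_eq_zero.1 this).resolve_right hfs.ne'
  intro x hx hxs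
  have := congrFun ht x
  simp only [Pi.smul_apply, smul_eq_mul, ht0, zero_mul, abs_of_nonneg hx, min_eq_left hxs] at this
  exact sub_eq_zero.1 this.symm

theorem eq_tent_of_extremal (hf : IsPolyaType f) (hf0 : f ≠ 0)
    (he : posPosDefInterval f = (fun t : ℝ => t • f) '' Set.Icc 0 1) :
    ∃ r : ℝ, 0 < r ∧ ∃ c : ℝ, 0 < c ∧ f = c • charConvChar r := by
  have h0 : 0 < f 0 := by
    refine (hf.nonneg 0).lt_of_ne fun h => hf0 (funext fun x => le_antisymm ?_ (hf.nonneg x))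
    rw [← hf.apply_abs]
    exact (hf.antitoneOn (Set.self_mem_Ici) (abs_nonneg x) (abs_nonneg x)).trans_eq h.symm
  have hivt : ∀ y, 0 < y → y ≤ f 0 → ∃ s, 0 ≤ s ∧ f s = y := by
    intro y hy hy0
    obtain ⟨b, hb, hb0⟩ := ((hf.tendsto_zero.eventually (gt_mem_nhds hy)).and
      (Filter.eventually_ge_atTop 0)).exists
    obtain ⟨s, hs, h⟩ := intermediate_value_Icc' hb0 hf.continuous.continuousOn ⟨hb.le, hy0⟩
    exact ⟨s, hs.1, h⟩
  obtain ⟨s₁, hs₁, hfs₁⟩ := hivt (f 0 / 2) (by linarith) (by linarith)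
  have hs₁0 : 0 < s₁ := hs₁.lt_of_ne (by rintro rfl; linarith)
  set a := (f 0 / 2) / s₁ with ha_def
  have ha : 0 < a := by positivity
  have has₁ : a * s₁ = f 0 / 2 := div_mul_cancel₀ _ hs₁0.ne'
  have haff : ∀ x, 0 ≤ x → 0 < f x → f x = f 0 - a * x := by
    intro x hx hfx
    -- Taking the larger of `x` and `s₁` puts 0, `s₁` and `x` on one affine piece, so its slope is
    -- always `-a`.
    have hpos : 0 < f (max x s₁) := by
      rcases max_choice x s₁ with h | h <;> rw [h]
      · exact hfx
      · linarith
    obtain ⟨b, hb⟩ := hf.eq_affine_of_extremal he (lt_max_of_lt_right hs₁0) hpos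
    have e0 := hb 0 le_rfl (le_max_of_le_left hx)
    have e1 := hb x hx (le_max_left _ _)
    have e2 := hb s₁ hs₁ (le_max_right _ _)
    have hba : b = -a := by
      rw [ha_def, eq_neg_iff_add_eq_zero]
      field_simp
      linarith
    rw [hba] at e0 e1
    linarith
  have hmain : ∀ x, 0 ≤ x → f x = max (f 0 - a * x) 0 := by
    intro x hx
    rcases (hf.nonneg x).lt_or_eq with h | h
    · have h1 := haff x hx h
      rw [h1, max_eq_left (h1 ▸ h.le)]
    · rw [← h, eq_comm, max_eq_right_iff]
      by_contra! hlt
      -- If `f` vanished at `x` while the line is still positive, it would take half the line's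
      -- value at some `y ≤ x`, where it must agree with the line and so be larger.
      obtain ⟨y, hy, hfy⟩ := hivt ((f 0 - a * x) / 2) (by linarith) (by nlinarith)
      have h1 := haff y hy (by linarith)
      have hyx : y ≤ x := by
        by_contra! hxy
        have := hf.antitoneOn (show (0 : ℝ) ≤ x from hx) hy hxy.le
        linarith
      nlinarith
  refine ⟨f 0 / a, by positivity, a, ha, funext fun x => ?_⟩
  rw [← hf.apply_abs, hmain _ (abs_nonneg x), Pi.smul_apply, charConvChar_apply, smul_eq_mul,
    mul_max_of_nonneg _ _ ha.le, mul_sub, mul_div_cancel₀ _ ha.ne', mul_zero]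

end IsPolyaType

/-! ### Domination and divisibility on the unit circle -/

open Polynomial in
-- Roots are peeled off one at a time. Cancelling `X - w` keeps the bound away from `w`; continuity
-- along the circle restores it at `w`, so repeated roots are covered.
theorem Polynomial.prod_X_sub_C_dvd_of_norm_eval_le (s : Multiset ℂ) (hs : ∀ w ∈ s, ‖w‖ = 1)
    (B : ℝ) (p : ℂ[X])
    (h : ∀ z : ℂ, ‖z‖ = 1 → ‖p.eval z‖ ≤ B * ‖((s.map fun w => X - C w).prod).eval z‖) :
    (s.map fun w => X - C w).prod ∣ p := by
  induction s using Multiset.induction_on generalizing p with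
  | empty => simp
  | cons w s ih =>
    have hw : ‖w‖ = 1 := hs w (Multiset.mem_cons_self w s)
    have hroot : p.IsRoot w := by
      have := h w hw
      rw [Multiset.map_cons, Multiset.prod_cons] at this
      simpa using this
    obtain ⟨q, rfl⟩ := dvd_iff_isRoot.2 hroot
    rw [Multiset.map_cons, Multiset.prod_cons]
    refine mul_dvd_mul_left _ (ih (fun v hv => hs v (Multiset.mem_cons_of_mem hv)) q ?_)
    have hne : ∀ z : ℂ, ‖z‖ = 1 → z ≠ w →
        ‖q.eval z‖ ≤ B * ‖((s.map fun w => X - C w).prod).eval z‖ := by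
      intro z hz hzw
      have h1 := h z hz
      rw [Multiset.map_cons, Multiset.prod_cons, eval_mul, eval_mul, norm_mul, norm_mul] at h1
      have h2 : 0 < ‖(X - C w).eval z‖ := by simpa [sub_eq_zero] using hzw
      nlinarith
    intro z hz
    by_cases hzw : z = w
    · subst hzw
      let φ : ℝ → ℂ := fun t => z * Complex.exp (t * Complex.I)
      have hd : HasDerivAt φ (z * Complex.I) 0 := by
        have h1 : HasDerivAt (fun t : ℝ => (t : ℂ) * Complex.I) Complex.I 0 := by
          simpa using (Complex.ofRealCLM.hasDerivAt (x := (0 : ℝ))).mul_const Complex.I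
        simpa using h1.cexp.const_mul z
      have hz0 : z ≠ 0 := by
        rintro rfl
        simp at hz
      -- The nonzero derivative makes the path on the circle leave `z` at once.
      have hev : ∀ᶠ t in nhdsWithin (0 : ℝ) {0}ᶜ, φ t ≠ z :=
        hd.eventually_ne (mul_ne_zero hz0 Complex.I_ne_zero)
      have hφ0 : φ 0 = z := by simp [φ]
      have hφ : Filter.Tendsto φ (nhdsWithin 0 {0}ᶜ) (nhds z) := by
        have := hd.continuousAt.tendsto
        rw [hφ0] at this
        exact this.mono_left nhdsWithin_le_nhds
      refine le_of_tendsto_of_tendsto ((q.continuous.norm.tendsto z).comp hφ)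
        ((((Multiset.map (fun w => X - C w) s).prod.continuous.norm.tendsto z).comp
          hφ).const_mul B) ?_
      filter_upwards [hev] with t ht
      exact hne _ (by simp [φ, hz, Complex.norm_exp_ofReal_mul_I]) ht
    · exact hne z hz hzw

open Polynomial in
/-- On the unit circle, domination by a polynomial with all its roots there forces divisibility. -/
theorem Polynomial.dvd_of_norm_eval_le {p q : ℂ[X]} (hq : q ≠ 0)
    (hroots : ∀ w, q.IsRoot w → ‖w‖ = 1) (h : ∀ z : ℂ, ‖z‖ = 1 → ‖p.eval z‖ ≤ ‖q.eval z‖) :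
    q ∣ p := by
  have hfac := (IsAlgClosed.splits q).eq_prod_roots
  have hu : IsUnit (C q.leadingCoeff) := isUnit_C.2 (leadingCoeff_ne_zero.2 hq).isUnit
  rw [hfac]
  refine hu.mul_left_dvd.2 (prod_X_sub_C_dvd_of_norm_eval_le _
    (fun w hw => hroots w (isRoot_of_mem_roots hw)) ‖q.leadingCoeff‖ p fun z hz => ?_)
  refine (h z hz).trans_eq ?_
  conv_lhs => rw [hfac]
  rw [eval_mul, eval_C, norm_mul]

open Polynomial in
-- Identifies the symbol of a lattice tent, shifted by `L`, with the square of a geometric sum.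
theorem Polynomial.coeff_geom_sum_sq (L k : ℕ) (hk : k ≤ 2 * L) :
    ((∑ i ∈ Finset.range (L + 1), (X : ℂ[X]) ^ i) ^ 2).coeff k =
      ((L + 1 - ((k : ℤ) - L).natAbs : ℕ) : ℂ) := by
  rw [sq, coeff_mul, Finset.Nat.sum_antidiagonal_eq_sum_range_succ_mk]
  simp only [finsetSum_coeff, coeff_X_pow, Finset.sum_ite_eq, Finset.mem_range, ← ite_and,
    mul_ite, mul_one, mul_zero, Finset.sum_boole]
  have : {i ∈ Finset.range k.succ | k - i < L + 1 ∧ i < L + 1} =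
      Finset.Ico (k - L) (min (L + 1) (k + 1)) := by
    ext i
    simp only [Finset.mem_filter, Finset.mem_range, Finset.mem_Ico]
    omega
  rw [this, Nat.card_Ico]
  congr 1
  omega

/-! ### Toeplitz sums and symbols -/

/-- A finitely supported sequence on `ℤ` whose Toeplitz sums are nonnegative has a nonnegative
total sum. -/
theorem sum_nonneg_of_toeplitz_nonneg {L : ℕ} {b : ℤ → ℂ} (hb : ∀ j : ℤ, L < j.natAbs → b j = 0)
    (hT : ∀ N : ℕ, 0 ≤ ∑ m ∈ Finset.range N, ∑ n ∈ Finset.range N, b ((m : ℤ) - n)) :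
    0 ≤ ∑ k ∈ Finset.range (2 * L + 1), b ((k : ℤ) - L) := by
  set T : ℕ → ℂ := fun N => ∑ m ∈ Finset.range N, ∑ n ∈ Finset.range N, b ((m : ℤ) - n)
  set S := ∑ k ∈ Finset.range (2 * L + 1), b ((k : ℤ) - L) with hS
  have hpos : ∀ N, L ≤ N → ∑ n ∈ Finset.range N, b ((N : ℤ) - n) =
      ∑ i ∈ Finset.range L, b ((i : ℤ) + 1) := by
    intro N hN
    rw [← Finset.sum_range_reflect, ← Finset.sum_subset (Finset.range_mono hN)]
    · refine Finset.sum_congr rfl fun i hi => congrArg b ?_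
      have := Finset.mem_range.1 hi
      omega
    · intro i hi hi'
      rw [Finset.mem_range] at hi hi'
      exact hb _ (by omega)
  have hneg : ∀ N, L ≤ N → ∑ n ∈ Finset.range N, b ((n : ℤ) - N) =
      ∑ i ∈ Finset.range L, b ((i : ℤ) - L) := by
    intro N hN
    rw [← Finset.sum_range_reflect, ← Finset.sum_range_reflect (fun i : ℕ => b ((i : ℤ) - L)),
      ← Finset.sum_subset (Finset.range_mono hN)]
    · refine Finset.sum_congr rfl fun i hi => congrArg b ?_
      have := Finset.mem_range.1 hi
      omega
    · intro i hi hi'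
      rw [Finset.mem_range] at hi hi'
      exact hb _ (by omega)
  have hSsplit : S = (∑ i ∈ Finset.range L, b ((i : ℤ) - L)) +
      ((∑ i ∈ Finset.range L, b ((i : ℤ) + 1)) + b 0) := by
    rw [hS, show 2 * L + 1 = L + (L + 1) by ring, Finset.sum_range_add, Finset.sum_range_succ']
    congr 2
    · exact Finset.sum_congr rfl fun i _ => congrArg b (by push_cast; ring)
    · simp
  -- Once `N ≥ L`, the new row, column and corner contain every nonzero term exactly once. So `T`
  -- grows linearly with slope `S`, and dividing by the growing size yields `0 ≤ S`.
  have hstep : ∀ N, L ≤ N → T (N + 1) = T N + S := by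
    intro N hN
    simp only [T, Finset.sum_range_succ, Finset.sum_add_distrib, hpos N hN, hneg N hN, sub_self]
    rw [hSsplit]
    ring
  have hlin : ∀ k : ℕ, T (L + k) = T L + k * S := by
    intro k
    induction k with
    | zero => simp
    | succ k ih =>
      rw [← add_assoc, hstep _ (Nat.le_add_right _ _), ih]
      push_cast
      ring
  have hkS : ∀ k : ℕ, 0 ≤ T L + k * S := fun k => hlin k ▸ hT (L + k)
  have hlim : Filter.Tendsto (fun k : ℕ => (((1 / ((k : ℝ) + 1) : ℝ)) : ℂ) * T L + S) Filter.atTop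
      (nhds S) := by
    have h := (Complex.continuous_ofReal.tendsto 0).comp
      (tendsto_one_div_add_atTop_nhds_zero_nat (𝕜 := ℝ))
    simpa using (h.mul_const (T L)).add_const S
  refine ge_of_tendsto' hlim fun k => ?_
  have h1 : (0 : ℂ) ≤ ((1 / ((k : ℝ) + 1) : ℝ) : ℂ) := Complex.zero_le_real.2 (by positivity)
  refine (mul_nonneg h1 (hkS (k + 1))).trans_eq ?_
  have : (k : ℂ) + 1 ≠ 0 := Nat.cast_add_one_ne_zero k
  push_cast
  field_simp

namespace IsPositiveDefiniteFun

/-- Testing positive definiteness at the points `j * h` with coefficients `z ^ j` gives the Toeplitz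
sums of `g (j * h) * z ^ j`. -/
theorem toeplitz_symbol_nonneg {g : ℝ → ℝ} (hg : IsPositiveDefiniteFun fun x => (g x : ℂ))
    {L : ℕ} {h : ℝ} (hsupp : ∀ j : ℤ, L < j.natAbs → g (j * h) = 0) {z : ℂ} (hz : ‖z‖ = 1) :
    0 ≤ ∑ k ∈ Finset.range (2 * L + 1), (g (((k : ℤ) - L : ℤ) * h) : ℂ) * z ^ ((k : ℤ) - L) := by
  refine sum_nonneg_of_toeplitz_nonneg (b := fun j : ℤ => (g (j * h) : ℂ) * z ^ j)
    (fun j hj => by simp [hsupp j hj]) fun N => ?_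
  have hz0 : z ≠ 0 := norm_ne_zero_iff.1 (by rw [hz]; exact one_ne_zero)
  refine (hg N (fun j => j * h) fun j => z ^ (j : ℕ)).trans_eq ?_
  rw [← Fin.sum_univ_eq_sum_range
    (fun m => ∑ n ∈ Finset.range N, (g (((m : ℤ) - n : ℤ) * h) : ℂ) * z ^ ((m : ℤ) - n))]
  refine Finset.sum_congr rfl fun m _ => ?_
  rw [← Fin.sum_univ_eq_sum_range
    (fun n => (g ((((m : ℕ) : ℤ) - n : ℤ) * h) : ℂ) * z ^ (((m : ℕ) : ℤ) - n))]
  refine Finset.sum_congr rfl fun n _ => ?_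
  have hconj : starRingEnd ℂ z = z⁻¹ := by
    rw [Complex.inv_def, Complex.normSq_eq_norm_sq, hz]
    simp
  rw [map_pow, hconj, zpow_sub₀ hz0, zpow_natCast, zpow_natCast, mul_comm, inv_pow, ← sub_mul]
  push_cast
  rfl

end IsPositiveDefiniteFun

/-! ### Tents are extremal -/

open Polynomial in
/-- The only minorants of a tent in the positive definite order are, on a lattice dividing the
support, multiples of the tent. -/
theorem eq_tent_on_lattice {f g : ℝ → ℝ} (hg : IsPositiveDefiniteFun fun x => (g x : ℂ))
    (hfg : IsPositiveDefiniteFun fun x => ((f - g) x : ℂ)) {L : ℕ} {h c : ℝ} (hc : 0 < c)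
    (hf : ∀ j : ℤ, f (j * h) = c * ((L + 1 - j.natAbs : ℕ) : ℝ))
    (hsupp : ∀ j : ℤ, L < j.natAbs → g (j * h) = 0) {j : ℤ} (hj : j.natAbs ≤ L) :
    g (j * h) = g 0 * (((L + 1 - j.natAbs : ℕ) : ℝ) / (L + 1)) := by
  set D : ℂ[X] := ∑ i ∈ Finset.range (L + 1), X ^ i with hD
  have hDm : D.Monic := monic_geom_sum_X L.succ_ne_zero
  have hDdeg : D.natDegree = L := by
    have h1 : D * (X - 1) = X ^ (L + 1) - 1 := geom_sum_mul X (L + 1)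
    have h2 := congrArg natDegree h1
    rw [← C_1, natDegree_X_pow_sub_C, hDm.natDegree_mul (monic_X_sub_C 1), natDegree_X_sub_C] at h2
    omega
  let p : (ℝ → ℝ) → ℂ[X] := fun u =>
    ∑ k ∈ Finset.range (2 * L + 1), C (u (((k : ℤ) - L : ℤ) * h) : ℂ) * X ^ k
  have hcoeff : ∀ u k, k ≤ 2 * L → (p u).coeff k = (u (((k : ℤ) - L : ℤ) * h) : ℂ) := by
    intro u k hk
    simp only [p, finsetSum_coeff, coeff_C_mul_X_pow]
    rw [Finset.sum_ite_eq, if_pos (Finset.mem_range.2 (by omega))]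
  have hdeg : ∀ u, (p u).natDegree ≤ 2 * L := fun u =>
    natDegree_sum_le_of_forall_le _ _ fun k hk =>
      (natDegree_C_mul_X_pow_le _ _).trans (by have := Finset.mem_range.1 hk; omega)
  have hD2deg : (D ^ 2).natDegree = 2 * L := by rw [hDm.natDegree_pow, hDdeg]
  have hpf : p f = C (c : ℂ) * D ^ 2 := by
    ext k
    rw [coeff_C_mul]
    by_cases hk : k ≤ 2 * L
    · rw [hcoeff f k hk, hD, coeff_geom_sum_sq L k hk, hf]
      push_cast
      rfl
    · rw [coeff_eq_zero_of_natDegree_lt ((hdeg f).trans_lt (by omega)),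
        coeff_eq_zero_of_natDegree_lt (p := D ^ 2) (by omega), mul_zero]
  have heval : ∀ (u : ℝ → ℝ) (z : ℂ), ‖z‖ = 1 → (p u).eval z = z ^ L *
      ∑ k ∈ Finset.range (2 * L + 1), (u (((k : ℤ) - L : ℤ) * h) : ℂ) * z ^ ((k : ℤ) - L) := by
    intro u z hz
    have hz0 : z ≠ 0 := norm_ne_zero_iff.1 (by rw [hz]; exact one_ne_zero)
    simp only [p, eval_finsetSum, eval_mul, eval_C, eval_pow, eval_X, Finset.mul_sum]
    refine Finset.sum_congr rfl fun k _ => ?_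
    rw [zpow_sub₀ hz0, zpow_natCast, zpow_natCast]
    field_simp
  -- The factor `z ^ L` has norm 1, so the order between the two nonnegative symbols becomes an
  -- inequality of norms.
  have hle : ∀ z : ℂ, ‖z‖ = 1 → ‖(p g).eval z‖ ≤ ‖(p f).eval z‖ := by
    intro z hz
    rw [heval g z hz, heval f z hz, norm_mul, norm_mul]
    refine mul_le_mul_of_nonneg_left ?_ (norm_nonneg _)
    have h1 := hg.toeplitz_symbol_nonneg hsupp hz
    have h2 := hfg.toeplitz_symbol_nonneg (L := L) (h := h) (fun j hj => by
      rw [Pi.sub_apply, hsupp j hj, hf, Nat.sub_eq_zero_of_le hj]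
      simp) hz
    refine CStarAlgebra.norm_le_norm_of_nonneg_of_le h1 (sub_nonneg.1 (h2.trans_eq ?_))
    rw [← Finset.sum_sub_distrib]
    refine Finset.sum_congr rfl fun k _ => ?_
    simp only [Pi.sub_apply]
    push_cast
    ring
  have hcC : (c : ℂ) ≠ 0 := Complex.ofReal_ne_zero.2 hc.ne'
  have hdvd : D ^ 2 ∣ p g := by
    refine (Dvd.intro_left _ hpf.symm).trans (dvd_of_norm_eval_le ?_ (fun w hw => ?_) hle)
    · rw [hpf]
      exact mul_ne_zero (C_ne_zero.2 hcC) (hDm.pow 2).ne_zero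
    · rw [hpf, IsRoot.def, eval_mul, eval_C, eval_pow] at hw
      have hw0 : D.eval w = 0 := by simpa [hcC] using hw
      -- Roots of the geometric sum are roots of unity.
      have h1 := geom_sum_mul w (L + 1)
      rw [hD, eval_geom_sum] at hw0
      rw [hw0, zero_mul] at h1
      exact Complex.norm_eq_one_of_pow_eq_one (sub_eq_zero.1 h1.symm) L.succ_ne_zero
  obtain ⟨q, hq⟩ := hdvd
  have hq0 : q.natDegree = 0 := by
    by_cases hq0 : q = 0
    · simp [hq0]
    · have := hdeg g
      rw [hq, (hDm.pow 2).natDegree_mul' hq0, hD2deg] at this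
      omega
  obtain ⟨t, rfl⟩ := natDegree_eq_zero.1 hq0
  have hval : ∀ i : ℤ, i.natAbs ≤ L → (g (i * h) : ℂ) = ((L + 1 - i.natAbs : ℕ) : ℂ) * t := by
    intro i hi
    obtain ⟨k, hk⟩ := Int.eq_ofNat_of_zero_le (show 0 ≤ i + L by omega)
    have hk' : i = (k : ℤ) - L := by omega
    subst hk'
    have hk2 : k ≤ 2 * L := by omega
    rw [← hcoeff g k hk2, hq, coeff_mul_C, hD, coeff_geom_sum_sq L k hk2]
  have h0 := hval 0 (by simp)
  have hjv := hval j hj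
  have hL : (L : ℂ) + 1 ≠ 0 := Nat.cast_add_one_ne_zero L
  have ht : t = (g 0 : ℂ) / (L + 1) := by
    rw [eq_div_iff hL]
    simpa [mul_comm] using h0.symm
  apply Complex.ofReal_injective
  rw [hjv, ht]
  push_cast
  ring

theorem eq_smul_of_le_tent {g : ℝ → ℝ} {r c : ℝ} (hr : 0 < r) (hc : 0 < c)
    (hg : g ∈ posPosDefInterval (c • charConvChar r)) :
    g = (g 0 / (c * r)) • (c • charConvChar r) := by
  obtain ⟨⟨hgc, -, hgpd, hg0⟩, -, -, hfgpd, hfg0⟩ := hg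
  have hfx : ∀ x, (c • charConvChar r) x = c * max (r - |x|) 0 := fun x => by
    rw [Pi.smul_apply, charConvChar_apply, smul_eq_mul]
  -- Pointwise nonnegativity of both `g` and `f - g` is essential here.
  have hsupp : ∀ x, r ≤ |x| → g x = 0 := by
    intro x hx
    have h := hfg0 x
    rw [Pi.sub_apply, hfx, max_eq_right (by linarith), mul_zero] at h
    exact le_antisymm (by linarith) (hg0 x)
  have hrat : ∀ q : ℚ, g (q * r) = g 0 * max (1 - |(q : ℝ)|) 0 := by
    intro q
    -- With denominator `L + 1`, the lattice of step `r / (L + 1)` contains both `q * r` and `r`.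
    obtain ⟨L, hL⟩ := Nat.exists_eq_succ_of_ne_zero q.den_nz
    have hL1 : (0 : ℝ) < (L : ℝ) + 1 := by positivity
    have hq : (q : ℝ) = q.num / ((L : ℝ) + 1) := by
      conv_lhs => rw [Rat.cast_def, hL]
      push_cast
      rfl
    have hqr : (q : ℝ) * r = q.num * (r / (L + 1)) := by rw [hq]; ring
    have habs : ∀ j : ℤ, |(j : ℝ) * (r / (L + 1))| = j.natAbs * (r / (L + 1)) := fun j => by
      rw [abs_mul, abs_of_nonneg (show 0 ≤ r / ((L : ℝ) + 1) by positivity), Nat.cast_natAbs,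
        Int.cast_abs]
    have hqabs : |(q : ℝ)| = q.num.natAbs / ((L : ℝ) + 1) := by
      rw [hq, abs_div, abs_of_pos hL1, Nat.cast_natAbs, Int.cast_abs]
    have hout : ∀ j : ℤ, L < j.natAbs → r ≤ j.natAbs * (r / ((L : ℝ) + 1)) := fun j hj => by
      rw [mul_div_assoc', le_div_iff₀ hL1, mul_comm]
      exact mul_le_mul_of_nonneg_right (by exact_mod_cast hj) hr.le
    rw [hqr, hqabs]
    by_cases hj : q.num.natAbs ≤ L
    · rw [eq_tent_on_lattice (L := L) (h := r / (L + 1)) (c := c * (r / (L + 1))) hgpd hfgpd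
        (by positivity) (fun j => ?_) (fun j hj => hsupp _ (by rw [habs]; exact hout j hj)) hj]
      · rw [Nat.cast_sub (by omega), max_eq_left]
        · push_cast
          field_simp
        · rw [sub_nonneg, div_le_one hL1]
          exact_mod_cast hj.trans L.le_succ
      · rw [hfx, habs]
        by_cases hjL : j.natAbs ≤ L + 1
        · rw [Nat.cast_sub hjL, max_eq_left]
          · push_cast
            field_simp
          · rw [sub_nonneg, mul_div_assoc', div_le_iff₀ hL1, mul_comm]
            exact mul_le_mul_of_nonneg_left (by exact_mod_cast hjL) hr.le
        · rw [Nat.sub_eq_zero_of_le (by omega),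
            max_eq_right (by linarith [hout j (by omega)])]
          simp
    · rw [hsupp _ (by rw [habs]; exact hout _ (by omega)), max_eq_right, mul_zero]
      rw [sub_nonpos, one_le_div hL1]
      exact_mod_cast (not_le.1 hj)
  have hall : (fun x : ℝ => g (x * r)) = fun x => g 0 * max (1 - |x|) 0 :=
    Rat.denseRange_cast.equalizer (by fun_prop) (by fun_prop) (funext hrat)
  funext x
  have h := congrFun hall (x / r)
  simp only [div_mul_cancel₀ _ hr.ne'] at h
  rw [h, Pi.smul_apply, hfx, smul_eq_mul, abs_div, abs_of_pos hr]
  have : max (r - |x|) 0 = r * max (1 - |x| / r) 0 := by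
    rw [mul_max_of_nonneg _ _ hr.le, mul_sub, mul_div_cancel₀ _ hr.ne', mul_one, mul_zero]
  rw [this]
  field_simp

theorem smul_mem_posPosDefCone {f : ℝ → ℝ} (hf : f ∈ posPosDefCone) {t : ℝ} (ht : 0 ≤ t) :
    t • f ∈ posPosDefCone := by
  obtain ⟨hc, he, hpd, h0⟩ := hf
  refine ⟨hc.const_smul t, fun x => by simp [he x], fun n x c => ?_,
    fun x => mul_nonneg ht (h0 x)⟩
  have h := mul_nonneg (Complex.zero_le_real.2 ht) (hpd n x c)
  simp only [Finset.mul_sum] at h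
  refine h.trans_eq (Finset.sum_congr rfl fun j _ => Finset.sum_congr rfl fun k _ => ?_)
  simp only [Pi.smul_apply, smul_eq_mul]
  push_cast
  ring

theorem isExtremalRayGenerator_tent {r c : ℝ} (hr : 0 < r) (hc : 0 < c)
    (hmem : c • charConvChar r ∈ posPosDefCone) :
    IsExtremalRayGenerator (c • charConvChar r) := by
  refine ⟨hmem, Set.Subset.antisymm (fun g hg => ?_) ?_⟩
  · refine ⟨g 0 / (c * r), ⟨div_nonneg (hg.1.2.2.2 0) (by positivity), ?_⟩,
      (eq_smul_of_le_tent hr hc hg).symm⟩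
    have h := hg.2.2.2.2 0
    rw [Pi.sub_apply, Pi.smul_apply, charConvChar_apply, abs_zero, sub_zero, max_eq_left hr.le,
      smul_eq_mul] at h
    rw [div_le_one (by positivity)]
    linarith
  · rintro _ ⟨t, ht, rfl⟩
    refine ⟨smul_mem_posPosDefCone hmem ht.1, ?_⟩
    have := smul_mem_posPosDefCone hmem (sub_nonneg.2 ht.2)
    rwa [sub_smul, one_smul] at this

theorem mainTheorem9 (f : ℝ → ℝ) (hf : IsPolyaType f) :
    f ∈ posPosDefCone ∧
      (f ≠ 0 →
        (IsExtremalRayGenerator f ↔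
          ∃ r : ℝ, 0 < r ∧ ∃ c : ℝ, 0 < c ∧ f = c • charConvChar r)) := by
  refine ⟨hf.mem_posPosDefCone, fun hf0 => ⟨fun he => hf.eq_tent_of_extremal hf0 he.2, ?_⟩⟩
  rintro ⟨r, hr, c, hc, rfl⟩
  exact isExtremalRayGenerator_tent hr hc hf.mem_posPosDefCone
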